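/- **Setting.** Let $(Q,\le,\otimes,k)$ be a completely distributive commutative unital quantale whose unit $k$ is the greatest element, with $\bot\neq k$; write $\hom(u,-)$ for the right adjoint of $u\otimes-$. Let $\mathbb U=(U,e,m)$ be the ultrafilter monad on sets and $\xi\colon UQ\to Q$, $\xi(\sigma)=\bigwedge_{A\in\sigma}\bigvee A$. Assume that $(Q,\otimes,k)$ is a monoid in compact Hausdorff spaces for the topology with convergence $\xi$ (that is, $\xi(U(\otimes)(\omega))=\xi(U\pi_1\omega)\otimes\xi(U\pi_2\omega)$ for $\omega\in U(Q\times Q)$, and $\xi$ sends the image of every ultrafilter under the constant map $k\colon 1\to Q$ to $k$), and that, whenever $f\colon X\to Y$, $\varphi\colon X\to Q$, $\psi\colon Y\to Q$ satisfy $\psi(y)\le\bigvee_{fx=y}\varphi(x)$ for all $y$, then $\xi(U\psi(\sigma))\le\bigvee_{Uf(\nu)=\sigma}\xi(U\varphi(\nu))$ for all $\sigma\in UY$. For $r\colon X\times Y\to Q$ put $Ur(\sigma,\nu)=\bigwedge_{A\in\sigma,B\in\nu}\bigvee_{x\in A,y\in B}r(x,y)$. For $\alpha\colon UX\times Y\to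 Q$ put $\bar\alpha(\sigma,\nu)=\bigvee_{m_X(\Xi)=\sigma}U\alpha(\Xi,\nu)$ for $\sigma\in UX$, $\nu\in UY$. For $\beta\colon UY\times Z\to Q$ and $\gamma\colon UX\times Z\to Q$ let $$(\beta\circ\alpha)(\sigma,z)=\bigvee_{\nu\in UY}\bar\alpha(\sigma,\nu)\otimes\beta(\nu,z),\qquad(\gamma\mathbin{\circ\!-}\alpha)(\nu,z)=\bigwedge_{\sigma\in UX}\hom(\bar\alpha(\sigma,\nu),\gamma(\sigma,z)).$$ A $(\mathbb U,Q)$-category is a set $X$ with $X\colon UX\times X\to Q$ such that $k\le X(\dot x,x)$ and $UX(\Upsilon,\sigma)\otimes X(\sigma,x)\le X(m_X\Upsilon,x)$; a functor $f\colon X\to Y$ satisfies $X(\sigma,x)\le Y(Uf\sigma,fx)$. Write $x\le y$ if $k\le X(\dot x,y)$, and $x\cong y$ if $x\le y\le x$; functors are ordered pointwise, and adjunctions $f\dashv g$ of functors refer to this order. A distributor $\varphi\colon X\nrightarrow Y$ is a map $\varphi\colon UX\times Y\to Q$ with $\varphi\circ X=\varphi=Y\circ\varphi$. A map $f\colon X\to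 Y$ gives $f_*(\sigma,y)=Y(Uf\sigma,y)$ and $f^*(\nu,x)=Y(\nu,fx)$; points $x\in X$ are regarded as functors $1\to X$, where $1=(1,e_1^{op})$. The $(\mathbb U,Q)$-category $\widehat X$ consists of all distributors $\psi\colon X\nrightarrow 1$, regarded as maps $UX\to Q$, with $$\widehat X(\Upsilon,\psi)=\bigwedge\{\hom(\xi(U\mathrm{ev}(\omega)),\psi(m_X(U\pi_1\omega)))\mid\omega\in U(UX\times\widehat X),\ U\pi_2\omega=\Upsilon\},$$ that is, it is a full subcategory of the exponential $Q^{|X|}$. The mate of $v\colon X\nrightarrow Y$ is $\ulcorner v\urcorner\colon Y\to\widehat X$, $y\mapsto v(-,y)$. Let $J$ be a subcategory of the category of $(\mathbb U,Q)$-categories and distributors which contains $f^*$ for every functor $f$ and contains $\varphi\colon X\nrightarrow Y$ whenever $y^*\circ\varphi\in J$ for all $y\in Y$. Let $JX$ be the full subcategory of $\widehat X$ on the $J$-distributors $X\nrightarrow 1$, and $\mathbf y\colon X\to JX$, $x\mapsto X(-,x)$. A supremum of $\psi\colon X\nrightarrow 1$ is a point $x$ with $x_*=X\mathbin{\circ\!-}\psi$.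 A functor $f\colon X\to Y$ is $J$-cocontinuous if $f(x)\cong y$ whenever $\varphi\in JX$, $x$ is a supremum of $\varphi$ and $y$ is a supremum of $\varphi\circ f^*$. Let $X$ be a $J$-cocomplete $(\mathbb U,Q)$-category, that is, $\mathbf y\colon X\to JX$ has a left adjoint functor $\mathrm{Sup}\colon JX\to X$. A distributor $v\colon X\nrightarrow X$ is called * *approximating* if $v\in J$ and $X\mathbin{\circ\!-}v=X$; * *approximating at $x\in X$* if $v\in J$ and $X\mathbin{\circ\!-}(x^*\circ v)=x_*$; * *$J$-cocontinuous* if $\mathrm{Sup}^*\circ v=\mathbf y_*\circ v$; * *the way-below distributor* if it is the lifting of $\mathbf y_*\colon X\nrightarrow JX$ along $\mathrm{Sup}^*\colon X\nrightarrow JX$, i.e. for all distributors $\gamma\colon X\nrightarrow X$: $\mathrm{Sup}^*\circ\gamma\le\mathbf y_*$ if and only if $\gamma\le v$. **Theorem.** Let $v\colon X\nrightarrow X$ be a distributor in $J$ (so that $\ulcorner v\urcorner$ takes values in $JX$). Then the following are equivalent: 1. $\ulcorner v\urcorner\colon X\to JX$ is a functor and $\ulcorner v\urcorner\dashv\mathrm{Sup}$;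 2. $v$ is approximating and $v$ is the way-below distributor; 3. $v$ is approximating and $J$-cocontinuous; 4. $v$ is approximating at $x$ for every $x\in X$, and $J$-cocontinuous; 5. $v$ is approximating at $x$ for every $x\in X$, and $\ulcorner v\urcorner\colon X\to JX$ is a $J$-cocontinuous functor; 6. for all $\sigma\in UX$ and $\psi\in JX$, $\widehat X(U\ulcorner v\urcorner(\sigma),\psi)=X(\sigma,\mathrm{Sup}\,\psi)$. -/

import Mathlib

open scoped Quantale

universe u

namespace UVCategory

/-! ## The ultrafilter monad

The functor `U` and the unit `e` are Mathlib's `Ultrafilter`, `Ultrafilter.map` and `pure`. -/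

/-- The multiplication of the ultrafilter monad:
`A ∈ sum Υ` if and only if `{σ | A ∈ σ} ∈ Υ`. -/
def sum {X : Type u} (Υ : Ultrafilter (Ultrafilter X)) : Ultrafilter X := Υ.bind id

theorem mem_sum {X : Type u} {Υ : Ultrafilter (Ultrafilter X)} {A : Set X} :
    A ∈ sum Υ ↔ {σ : Ultrafilter X | A ∈ σ} ∈ Υ := Iff.rfl

/-- The convergence `ξ : UQ → Q`, `ξ σ = ⋀_{A ∈ σ} ⋁ A`, of the Lawson topology. -/
def xi {Q : Type u} [CompletelyDistribLattice Q] (σ : Ultrafilter Q) : Q :=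
  ⨅ A ∈ σ, sSup A

/-- The standing assumptions on the quantale `(Q, ≤, *, 1)`, besides being a completely
distributive commutative unital quantale: the unit is the greatest element and differs from `⊥`,
`(Q, *, 1)` is a monoid in the category of compact Hausdorff spaces for the topology with
convergence `ξ`, and the technical property of strict topological theories holds. -/
class StrictTheory (Q : Type u) [CompletelyDistribLattice Q] [CommMonoid Q] [IsQuantale Q] :
    Prop where
  one_eq_top : (1 : Q) = ⊤
  bot_ne_one : (⊥ : Q) ≠ 1
  xi_one : ∀ σ : Ultrafilter PUnit.{u + 1}, xi (σ.map fun _ => (1 : Q)) = 1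
  xi_mul : ∀ ω : Ultrafilter (Q × Q),
    xi (ω.map fun p => p.1 * p.2) = xi (ω.map Prod.fst) * xi (ω.map Prod.snd)
  xi_fiber : ∀ {X Y : Type u} (f : X → Y) (φ : X → Q) (ψ : Y → Q),
    (∀ y, ψ y ≤ ⨆ (x : X) (_ : f x = y), φ x) →
      ∀ σ : Ultrafilter Y,
        xi (σ.map ψ) ≤ ⨆ (ν : Ultrafilter X) (_ : ν.map f = σ), xi (ν.map φ)

/-! ## Relations -/

section Relations

variable {Q : Type u} [CompletelyDistribLattice Q]

/-- The extension of `U` to `Q`-valued relations,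
`Ur(σ,ν) = ⋀_{A ∈ σ, B ∈ ν} ⋁_{x ∈ A, y ∈ B} r(x,y)`. -/
def ext {X Y : Type u} (r : X → Y → Q) (σ : Ultrafilter X) (ν : Ultrafilter Y) : Q :=
  ⨅ A ∈ σ, ⨅ B ∈ ν, ⨆ x ∈ A, ⨆ y ∈ B, r x y

/-- A `(U,Q)`-relation from `X` to `Y` is a `Q`-relation `UX → Y`. -/
abbrev KRel (Q : Type u) (X Y : Type u) : Type u := Ultrafilter X → Y → Q

/-- The `Q`-relation `Uα · m_Xᵒᵖ` from `UX` to `UY`. -/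
def extSum {X Y : Type u} (α : KRel Q X Y) (σ : Ultrafilter X) (ν : Ultrafilter Y) : Q :=
  ⨆ (Ξ : Ultrafilter (Ultrafilter X)) (_ : sum Ξ = σ), ext α Ξ ν

variable [CommMonoid Q]

/-- Kleisli convolution `β ∘ α = β · Uα · m_Xᵒᵖ`. -/
def kcomp {X Y Z : Type u} (β : KRel Q Y Z) (α : KRel Q X Y) : KRel Q X Z :=
  fun σ z => ⨆ ν : Ultrafilter Y, extSum α σ ν * β ν z

/-- The extension `γ ∘- α` of `γ` along `α`, that is, the extension of `γ : UX → Z` along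
`Uα · m_Xᵒᵖ : UX → UY` as `Q`-relations; `(-) ∘- α` is right adjoint to `(-) ∘ α`. -/
def kext {X Y Z : Type u} (γ : KRel Q X Z) (α : KRel Q X Y) : KRel Q Y Z :=
  fun ν z => ⨅ σ : Ultrafilter X, extSum α σ ν ⇨ᵣ γ σ z

end Relations

/-! ## `(U,Q)`-categories, functors and distributors -/

/-- A `(U,Q)`-category (small, with carrier in the universe of `Q`). -/
structure UVCat (Q : Type u) [CompletelyDistribLattice Q] [CommMonoid Q] where
  carrier : Type u
  str : KRel Q carrier carrier
  refl : ∀ x, 1 ≤ str (pure x) x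
  trans : ∀ (Υ : Ultrafilter (Ultrafilter carrier)) (σ : Ultrafilter carrier) (x : carrier),
    ext str Υ σ * str σ x ≤ str (sum Υ) x

instance {Q : Type u} [CompletelyDistribLattice Q] [CommMonoid Q] :
    CoeSort (UVCat Q) (Type u) := ⟨UVCat.carrier⟩

section Categories

variable {Q : Type u} [CompletelyDistribLattice Q] [CommMonoid Q]

/-- The underlying order of a `(U,Q)`-category: `x ≤ y` iff `1 ≤ X(ẋ, y)`. -/
def UVCat.le (X : UVCat Q) (x y : X) : Prop := 1 ≤ X.str (pure x) y

/-- Isomorphic points `x ≅ y` of a `(U,Q)`-category. -/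
def UVCat.iso (X : UVCat Q) (x y : X) : Prop := X.le x y ∧ X.le y x

/-- `f` is a `(U,Q)`-functor. -/
def IsFunctor (X Y : UVCat Q) (f : X → Y) : Prop :=
  ∀ (σ : Ultrafilter X) (x : X), X.str σ x ≤ Y.str (σ.map f) (f x)

/-- `f ⊣ g` in the category of `(U,Q)`-categories and `(U,Q)`-functors, ordered pointwise by the
underlying orders. -/
def IsAdjoint (X Y : UVCat Q) (f : X → Y) (g : Y → X) : Prop :=
  IsFunctor X Y f ∧ IsFunctor Y X g ∧ (∀ x, X.le x (g (f x))) ∧ ∀ y, Y.le (f (g y)) y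

/-- `φ : X ⇸ Y` is a `(U,Q)`-distributor. -/
def IsDist (X Y : UVCat Q) (φ : KRel Q X Y) : Prop :=
  kcomp φ X.str = φ ∧ kcomp Y.str φ = φ

/-- The distributor `f_* : X ⇸ Y`, `f_*(σ,y) = Y(Uf(σ), y)`. -/
def lowerStar {X : Type u} (Y : UVCat Q) (f : X → Y) : KRel Q X Y := fun σ y => Y.str (σ.map f) y

/-- The distributor `f^* : Y ⇸ X`, `f^*(ν,x) = Y(ν, f x)`. -/
def upperStar {X : Type u} (Y : UVCat Q) (f : X → Y) : KRel Q Y X := fun ν x => Y.str ν (f x)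

/-- `l : Y ⇸ Z` is the lifting of `φ : Y ⇸ X` along `ψ : Z ⇸ X`
in the ordered category of `(U,Q)`-distributors. -/
def IsLifting (X Y Z : UVCat Q) (ψ : KRel Q Z X) (φ : KRel Q Y X) (l : KRel Q Y Z) : Prop :=
  IsDist Y Z l ∧ ∀ γ : KRel Q Y Z, IsDist Y Z γ → (kcomp ψ γ ≤ φ ↔ γ ≤ l)

end Categories

/-! ## Basic facts on the extension of `U` and on `ξ` -/

section Theory

variable {Q : Type u} [CompletelyDistribLattice Q]

theorem ext_mono {X Y : Type u} {r s : X → Y → Q} (h : ∀ x y, r x y ≤ s x y)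
    (σ : Ultrafilter X) (ν : Ultrafilter Y) : ext r σ ν ≤ ext s σ ν :=
  iInf₂_mono fun _ _ => iInf₂_mono fun _ _ => iSup₂_mono fun _ _ => iSup₂_mono fun _ _ => h _ _

theorem ext_comap_le {X Y X' Y' : Type u} (r : X' → Y' → Q) (f : X → X') (g : Y → Y')
    (σ : Ultrafilter X) (ν : Ultrafilter Y) :
    ext (fun x y => r (f x) (g y)) σ ν ≤ ext r (σ.map f) (ν.map g) := by
  refine le_iInf₂ fun A hA => le_iInf₂ fun B hB => ?_
  refine (iInf₂_le (f ⁻¹' A) hA).trans ((iInf₂_le (g ⁻¹' B) hB).trans ?_)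
  refine iSup₂_le fun x hx => iSup₂_le fun y hy => ?_
  exact (le_iSup₂_of_le (f x) hx (le_iSup₂_of_le (g y) hy le_rfl))

theorem ext_pure_map {X Y : Type u} (r : X → Y → Q) (f : X → Y) (σ : Ultrafilter X) {u : Q}
    (h : ∀ x, u ≤ r x (f x)) : u ≤ ext r σ (σ.map f) := by
  refine le_iInf₂ fun A hA => le_iInf₂ fun B hB => ?_
  obtain ⟨x, hx, hxB⟩ := Ultrafilter.nonempty_of_mem (Filter.inter_mem hA hB)
  exact le_iSup₂_of_le x hx (le_iSup₂_of_le (f x) hxB (h x))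

theorem le_xi {u : Q} {σ : Ultrafilter Q} (h : Set.Ici u ∈ σ) : u ≤ xi σ := by
  refine le_iInf₂ fun A hA => ?_
  obtain ⟨a, ha, hu⟩ := Ultrafilter.nonempty_of_mem (Filter.inter_mem hA h)
  exact le_trans (show u ≤ a from hu) (le_sSup ha)

theorem xi_le {z : Q} {σ : Ultrafilter Q} (h : ∀ u, Set.Ici u ∈ σ → u ≤ z) : xi σ ≤ z := by
  have e : xi σ = ⨅ A : {A : Set Q // A ∈ σ}, ⨆ a : A.1, (a : Q) := by
    simp only [xi, iInf_subtype, sSup_eq_iSup']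
  rw [e, iInf_iSup_eq]
  refine iSup_le fun g => h _ ?_
  by_contra hn
  have hc := Ultrafilter.compl_mem_iff_notMem.2 hn
  exact (g ⟨_, hc⟩).2 (iInf_le (fun A : {A : Set Q // A ∈ σ} => ((g A : A.1) : Q)) ⟨_, hc⟩)

theorem xi_mono {X : Type u} {f g : X → Q} (h : ∀ x, f x ≤ g x) (σ : Ultrafilter X) :
    xi (σ.map f) ≤ xi (σ.map g) :=
  xi_le fun _ hu => le_xi (Filter.mem_of_superset (x := f ⁻¹' Set.Ici _) hu
    fun x (hx : _ ≤ f x) => le_trans hx (h x))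

theorem xi_sum_le (W : Ultrafilter (Ultrafilter Q)) : xi (sum W) ≤ xi (W.map xi) :=
  xi_le fun u hu => le_xi (Filter.mem_of_superset (x := {σ : Ultrafilter Q | Set.Ici u ∈ σ}) hu
    fun _ hσ => (le_xi hσ : u ≤ _))

theorem exists_ultrafilter {X Y : Type u} (σ : Ultrafilter X) (ν : Ultrafilter Y)
    (C : Set (X × Y)) (h : ∀ A ∈ σ, ∀ B ∈ ν, ∃ p ∈ C, p.1 ∈ A ∧ p.2 ∈ B) :
    ∃ ω : Ultrafilter (X × Y), C ∈ ω ∧ ω.map Prod.fst = σ ∧ ω.map Prod.snd = ν := by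
  have hne : (((σ : Filter X) ×ˢ (ν : Filter Y)) ⊓ Filter.principal C).NeBot := by
    rw [Filter.inf_principal_neBot_iff]
    intro S hS
    obtain ⟨A, hA, B, hB, hAB⟩ := Filter.mem_prod_iff.1 hS
    obtain ⟨p, hp, h1, h2⟩ := h A hA B hB
    exact ⟨p, hAB ⟨h1, h2⟩, hp⟩
  obtain ⟨ω, hω⟩ := Ultrafilter.exists_le (((σ : Filter X) ×ˢ (ν : Filter Y)) ⊓ Filter.principal C)
  refine ⟨ω, Filter.le_principal_iff.1 (hω.trans inf_le_right), ?_, ?_⟩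
  · refine Ultrafilter.coe_le_coe.1 fun A hA => ?_
    exact (hω.trans inf_le_left) (Filter.tendsto_fst hA)
  · refine Ultrafilter.coe_le_coe.1 fun A hA => ?_
    exact (hω.trans inf_le_left) (Filter.tendsto_snd hA)

theorem ext_le {X Y : Type u} (r : X → Y → Q) (σ : Ultrafilter X) (ν : Ultrafilter Y) {z : Q}
    (h : ∀ ω : Ultrafilter (X × Y), ω.map Prod.fst = σ → ω.map Prod.snd = ν →
      xi (ω.map fun p => r p.1 p.2) ≤ z) : ext r σ ν ≤ z := by
  have e : ext r σ ν ≤ ⨅ A : {A : Set X // A ∈ σ} × {B : Set Y // B ∈ ν},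
      ⨆ a : {p : X × Y // p.1 ∈ A.1.1 ∧ p.2 ∈ A.2.1}, r a.1.1 a.1.2 := by
    refine le_iInf fun A => (iInf₂_le A.1.1 A.1.2).trans ((iInf₂_le A.2.1 A.2.2).trans ?_)
    refine iSup₂_le fun x hx => iSup₂_le fun y hy => ?_
    exact le_iSup (fun a : {p : X × Y // p.1 ∈ A.1.1 ∧ p.2 ∈ A.2.1} => r a.1.1 a.1.2)
      ⟨(x, y), hx, hy⟩
  refine e.trans ?_
  rw [iInf_iSup_eq]
  refine iSup_le fun g => ?_
  obtain ⟨u, hu⟩ : ∃ u, u = ⨅ A, r (g A).1.1 (g A).1.2 := ⟨_, rfl⟩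
  rw [← hu]
  obtain ⟨ω, hC, h1, h2⟩ := exists_ultrafilter σ ν {p | u ≤ r p.1 p.2}
    fun A hA B hB => ⟨(g (⟨A, hA⟩, ⟨B, hB⟩)).1, by
      rw [hu]
      exact iInf_le (fun A => r (g A).1.1 (g A).1.2) (⟨A, hA⟩, ⟨B, hB⟩),
      (g (⟨A, hA⟩, ⟨B, hB⟩)).2⟩
  refine le_trans (le_xi ?_) (h ω h1 h2)
  exact hC

theorem xi_le_ext {X Y : Type u} (r : X → Y → Q) (ω : Ultrafilter (X × Y)) :
    xi (ω.map fun p => r p.1 p.2) ≤ ext r (ω.map Prod.fst) (ω.map Prod.snd) := by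
  refine xi_le fun u hu => le_iInf₂ fun A hA => le_iInf₂ fun B hB => ?_
  obtain ⟨p, hp, hpA, hpB⟩ := Ultrafilter.nonempty_of_mem
    (Filter.inter_mem (show (fun p : X × Y => r p.1 p.2) ⁻¹' Set.Ici u ∈ ω from hu)
      (Filter.inter_mem (show Prod.fst ⁻¹' A ∈ ω from hA) (show Prod.snd ⁻¹' B ∈ ω from hB)))
  exact le_iSup₂_of_le p.1 hpA (le_iSup₂_of_le p.2 hpB hp)

/-- Given `ω` on `A × P` and `𝔷` on `UP × P` with `m (Uπ₁ 𝔷) = Uπ₂ ω`, there is a common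
refinement on `U(A × P) × P`. -/
theorem exists_refinement {A P : Type u} (ω : Ultrafilter (A × P))
    (Z : Ultrafilter (Ultrafilter P × P)) (h : ω.map Prod.snd = sum (Z.map Prod.fst)) :
    ∃ T : Ultrafilter (Ultrafilter (A × P) × P),
      T.map (fun t => (t.1.map Prod.snd, t.2)) = Z ∧ sum (T.map Prod.fst) = ω := by
  let G : Filter (Ultrafilter (A × P) × P) :=
    { sets := {V | ∃ S ∈ ω, {t : Ultrafilter (A × P) × P | S ∈ t.1} ⊆ V}
      univ_sets := ⟨Set.univ, Filter.univ_mem, Set.subset_univ _⟩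
      sets_of_superset := fun ⟨S, hS, hV⟩ hVW => ⟨S, hS, hV.trans hVW⟩
      inter_sets := fun ⟨S, hS, hV⟩ ⟨S', hS', hV'⟩ => ⟨S ∩ S', Filter.inter_mem hS hS',
        fun _ ht => ⟨hV (Filter.mem_of_superset ht Set.inter_subset_left),
          hV' (Filter.mem_of_superset ht Set.inter_subset_right)⟩⟩ }
  let q : Ultrafilter (A × P) × P → Ultrafilter P × P := fun t => (t.1.map Prod.snd, t.2)
  have hne : (Filter.comap q (Z : Filter (Ultrafilter P × P)) ⊓ G).NeBot := by
    rw [Filter.inf_neBot_iff]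
    rintro V ⟨D, hD, hDV⟩ V' ⟨S, hS, hSV'⟩
    have h1 : Prod.snd '' S ∈ sum (Z.map Prod.fst) := by
      rw [← h]
      exact Filter.image_mem_map hS
    have h2 : {d : Ultrafilter P × P | Prod.snd '' S ∈ d.1} ∈ Z := h1
    obtain ⟨d, hd, hdS⟩ := Ultrafilter.nonempty_of_mem (Filter.inter_mem hD h2)
    refine ⟨(Ultrafilter.ofComapInfPrincipal hdS, d.2), hDV ?_, hSV' ?_⟩
    · have e : q (Ultrafilter.ofComapInfPrincipal hdS, d.2) = d :=
        Prod.ext (Ultrafilter.ofComapInfPrincipal_eq_of_map hdS) rfl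
      exact Set.mem_preimage.2 (e.symm ▸ hd)
    · exact Ultrafilter.ofComapInfPrincipal_mem hdS
  obtain ⟨T, hT⟩ := Ultrafilter.exists_le
    (Filter.comap q (Z : Filter (Ultrafilter P × P)) ⊓ G)
  refine ⟨T, ?_, ?_⟩
  · refine Ultrafilter.coe_le_coe.1 fun D hD => ?_
    exact (hT.trans inf_le_left) (Filter.preimage_mem_comap hD)
  · refine Ultrafilter.coe_le_coe.1 fun S hS => ?_
    exact (hT.trans inf_le_right) ⟨S, hS, subset_rfl⟩

theorem sum_map_map {X Y : Type u} (f : X → Y) (W : Ultrafilter (Ultrafilter X)) :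
    sum (W.map (Ultrafilter.map f)) = (sum W).map f := rfl

theorem sum_map_sum {X : Type u} (W : Ultrafilter (Ultrafilter (Ultrafilter X))) :
    sum (W.map sum) = sum (sum W) := rfl

theorem sum_map_pure {X : Type u} (σ : Ultrafilter X) : sum (σ.map pure) = σ := rfl

theorem sum_pure {X : Type u} (σ : Ultrafilter X) : sum (pure σ) = σ := rfl

theorem ultrafilter_punit (σ : Ultrafilter PUnit.{u + 1}) : σ = pure PUnit.unit := by
  refine Ultrafilter.coe_le_coe.1 fun A hA => ?_
  have hA' : PUnit.unit ∈ A := hA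
  have : A = Set.univ := Set.eq_univ_of_forall fun _ => hA'
  rw [this]
  exact Filter.univ_mem

end Theory

/-! ## Points, presheaves and the Yoneda functor -/

section Presheaves

variable {Q : Type u} [CompletelyDistribLattice Q] [CommMonoid Q] [IsQuantale Q] [StrictTheory Q]

theorem le_one' (a : Q) : a ≤ 1 := StrictTheory.one_eq_top (Q := Q) ▸ le_top

/-- The one-point `(U,Q)`-category `1 = (1, e_1ᵒᵖ)`. -/
def One (Q : Type u) [CompletelyDistribLattice Q] [CommMonoid Q] [IsQuantale Q]
    [StrictTheory Q] : UVCat Q where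
  carrier := PUnit
  str := fun σ x => ⨆ _h : σ = pure x, 1
  refl := fun x => le_iSup (fun _ : (pure x : Ultrafilter PUnit.{u + 1}) = pure x => (1 : Q)) rfl
  trans Υ σ x := (le_one' _).trans
    (le_iSup (fun _ : sum Υ = pure x => (1 : Q)) (ultrafilter_punit _))

/-- The point `x` of `X` as a functor `1 → X`. -/
def pt {X : UVCat Q} (x : X) : One Q → X := fun _ => x

theorem isFunctor_pt {X : UVCat Q} (x : X) : IsFunctor (One Q) X (pt x) := by
  intro σ y
  rw [ultrafilter_punit σ]
  exact (le_one' _).trans (X.refl x)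

theorem extSum_mul_le {X Y : Type u} (α : KRel Q X Y) (σ : Ultrafilter X) (ν : Ultrafilter Y)
    {c z : Q} (h : ∀ Ξ, sum Ξ = σ → ext α Ξ ν * c ≤ z) : extSum α σ ν * c ≤ z :=
  Quantale.leftMulResiduation_le_iff_mul_le.1 <| iSup₂_le fun Ξ hΞ =>
    Quantale.leftMulResiduation_le_iff_mul_le.2 (h Ξ hΞ)

theorem kcomp_str_self (X : UVCat Q) : kcomp X.str X.str = X.str := by
  funext σ x
  refine le_antisymm (iSup_le fun ν => extSum_mul_le _ _ _ fun Ξ h => h ▸ X.trans Ξ ν x) ?_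
  refine le_iSup_of_le σ ?_
  have : (1 : Q) ≤ extSum X.str σ σ := by
    refine le_iSup₂_of_le (σ.map pure) (sum_map_pure σ) ?_
    have h := ext_pure_map (fun x (ν : Ultrafilter X) => X.str ν x) pure σ (u := (1 : Q)) X.refl
    refine h.trans (le_iInf₂ fun A hA => le_iInf₂ fun B hB => ?_)
    refine (iInf₂_le B hB).trans ((iInf₂_le A hA).trans ?_)
    exact iSup₂_le fun x hx => iSup₂_le fun ν hν => le_iSup₂_of_le ν hν (le_iSup₂_of_le x hx le_rfl)
  calc X.str σ x = 1 * X.str σ x := (one_mul _).symm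
    _ ≤ _ := mul_le_mul' this le_rfl

theorem xi_le_ext_pure {X Y : Type u} (r : X → Y → Q) (σ : Ultrafilter X) (y : Y) :
    xi (σ.map fun x => r x y) ≤ ext r σ (pure y) := by
  refine xi_le fun u hu => le_iInf₂ fun A hA => le_iInf₂ fun B hB => ?_
  obtain ⟨x, hx, hxu⟩ := Ultrafilter.nonempty_of_mem
    (Filter.inter_mem hA (show (fun x => r x y) ⁻¹' Set.Ici u ∈ σ from hu))
  exact le_iSup₂_of_le x hx (le_iSup₂_of_le y hB hxu)

theorem isDist_mate {X Y : UVCat Q} {v : KRel Q X Y} (hv : IsDist X Y v) (y : Y) :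
    IsDist X (One Q) fun σ _ => v σ y := by
  refine ⟨?_, ?_⟩
  · funext σ _
    exact congrFun (congrFun hv.1 σ) y
  · funext σ t
    refine le_antisymm (iSup_le fun ν => ?_) ?_
    · rw [ultrafilter_punit ν]
      refine (mul_le_mul' le_rfl ((le_one' _).trans (Y.refl y))).trans ?_
      refine le_trans ?_ (congrFun (congrFun hv.2 σ) y).le
      refine le_trans ?_ (le_iSup _ (pure y))
      refine mul_le_mul' ?_ le_rfl
      refine iSup₂_mono fun Ξ _ => ?_
      exact ext_comap_le v id (fun _ : PUnit.{u + 1} => y) Ξ (pure PUnit.unit)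
    · refine le_iSup_of_le (pure PUnit.unit) ?_
      have h1 : v σ y ≤ extSum (fun σ (_ : PUnit.{u + 1}) => v σ y) σ (pure PUnit.unit) := by
        refine le_iSup₂_of_le (pure σ) (sum_pure σ) ?_
        exact le_iInf₂ fun A hA => le_iInf₂ fun B hB =>
          le_iSup₂_of_le σ hA (le_iSup₂_of_le PUnit.unit hB le_rfl)
      refine le_trans (mul_one _).ge (mul_le_mul' h1 ?_)
      exact (One Q).refl t

/-- The underlying set of `X̂`: the functions `ψ : UX → Q` which are distributors `X ⇸ 1`. -/
def Presheaf (X : UVCat Q) : Type u :=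
  {ψ : Ultrafilter X → Q // IsDist X (One Q) fun σ _ => ψ σ}

/-- The distributor `X ⇸ 1` given by a presheaf. -/
def Presheaf.rel {X : UVCat Q} (ψ : Presheaf X) : KRel Q X (One Q) := fun σ _ => ψ.1 σ

theorem Presheaf.xi_map_le {X : UVCat Q} (ψ : Presheaf X) (Ξ : Ultrafilter (Ultrafilter X)) :
    xi (Ξ.map ψ.1) ≤ ψ.1 (sum Ξ) := by
  refine le_trans ?_ (congrFun (congrFun ψ.2.2 (sum Ξ)) PUnit.unit).le
  refine le_trans ?_ (le_iSup _ (pure PUnit.unit))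
  refine le_trans (mul_one _).ge (mul_le_mul' ?_ ((One Q).refl _))
  exact le_iSup₂_of_le Ξ rfl
    (xi_le_ext_pure (fun σ (_ : PUnit.{u + 1}) => ψ.1 σ) Ξ PUnit.unit)

/-- The structure of `X̂` as a full subcategory of the exponential `Q^{|X|}`, where `Q` has the
structure `(σ,v) ↦ hom(ξ σ, v)` and `|X| = (UX, m_X)`: it is the largest structure for which
evaluation `|X| ⊗ X̂ → Q` is a functor, that is,
`X̂(Υ,ψ) = ⋀ hom(ξ (U ev ω), ψ σ)` over all `ω ∈ U(UX × X̂)` and `σ ∈ UX` with `Uπ₂ ω = Υ`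
and `m_X (Uπ₁ ω) = σ`. -/
def presheafStr (X : UVCat Q) : KRel Q (Presheaf X) (Presheaf X) := fun Υ ψ =>
  ⨅ (ω : Ultrafilter (Ultrafilter X × Presheaf X)) (_ : ω.map Prod.snd = Υ),
    xi (ω.map fun p => p.2.1 p.1) ⇨ᵣ ψ.1 (sum (ω.map Prod.fst))

theorem presheafStr_mul_le {X : UVCat Q} (ψ : Presheaf X)
    (ω : Ultrafilter (Ultrafilter X × Presheaf X)) :
    xi (ω.map fun p => p.2.1 p.1) * presheafStr X (ω.map Prod.snd) ψ ≤
      ψ.1 (sum (ω.map Prod.fst)) :=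
  Quantale.rightMulResiduation_le_iff_mul_le.1 ((iInf_le _ ω).trans (iInf_le _ rfl))

theorem presheafStr_refl (X : UVCat Q) (ψ : Presheaf X) : 1 ≤ presheafStr X (pure ψ) ψ := by
  refine le_iInf₂ fun ω hω => Quantale.rightMulResiduation_le_iff_mul_le.2 ?_
  rw [mul_one]
  refine le_trans (xi_le fun u hu => le_xi ?_) (ψ.xi_map_le _)
  have h1 : Prod.snd ⁻¹' {ψ} ∈ ω := by
    have : ({ψ} : Set (Presheaf X)) ∈ ω.map Prod.snd := by rw [hω]; exact rfl
    exact this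
  have h2 : (fun p : Ultrafilter X × Presheaf X => p.2.1 p.1) ⁻¹' Set.Ici u ∈ ω := hu
  have h3 : (fun p : Ultrafilter X × Presheaf X => ψ.1 p.1) ⁻¹' Set.Ici u ∈ ω := by
    refine Filter.mem_of_superset (Filter.inter_mem h1 h2) ?_
    rintro ⟨σ, φ⟩ ⟨hφ, h⟩
    obtain rfl : φ = ψ := hφ
    exact h
  exact h3

theorem presheafStr_trans (X : UVCat Q) (Y : Ultrafilter (Ultrafilter (Presheaf X)))
    (Υ : Ultrafilter (Presheaf X)) (ψ : Presheaf X) :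
    ext (presheafStr X) Y Υ * presheafStr X Υ ψ ≤ presheafStr X (sum Y) ψ := by
  refine Quantale.leftMulResiduation_le_iff_mul_le.1 (ext_le _ _ _ fun Z h1 h2 => ?_)
  refine Quantale.leftMulResiduation_le_iff_mul_le.2 (le_iInf₂ fun ω hω => ?_)
  refine Quantale.rightMulResiduation_le_iff_mul_le.2 ?_
  obtain ⟨T, hT1, hT2⟩ := exists_refinement ω Z (by rw [hω, h1])
  let ω' : Ultrafilter (Ultrafilter X × Presheaf X) :=
    T.map fun t => (sum (t.1.map Prod.fst), t.2)
  have e1 : ω'.map Prod.snd = Υ := by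
    rw [← h2, ← hT1, Ultrafilter.map_map, Ultrafilter.map_map]; rfl
  have e2 : sum (ω'.map Prod.fst) = sum (ω.map Prod.fst) := by
    rw [← hT2, ← sum_map_map, ← sum_map_sum]
    simp only [ω', Ultrafilter.map_map]
    rfl
  have key : xi (ω.map fun p => p.2.1 p.1) * xi (Z.map fun p => presheafStr X p.1 p.2) ≤
      xi (ω'.map fun p => p.2.1 p.1) := by
    have a1 : xi (ω.map fun p => p.2.1 p.1) ≤
        xi (T.map fun t => xi (t.1.map fun p => p.2.1 p.1)) := by
      rw [← hT2, ← sum_map_map]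
      refine (xi_sum_le _).trans ?_
      rw [Ultrafilter.map_map, Ultrafilter.map_map]
      exact le_rfl
    have a2 : xi (Z.map fun p => presheafStr X p.1 p.2) =
        xi (T.map fun t => presheafStr X (t.1.map Prod.snd) t.2) := by
      rw [← hT1, Ultrafilter.map_map]; rfl
    rw [a2]
    refine (mul_le_mul' a1 le_rfl).trans ?_
    have a3 := StrictTheory.xi_mul (T.map fun t => (xi (t.1.map fun p => p.2.1 p.1),
      presheafStr X (t.1.map Prod.snd) t.2))
    rw [Ultrafilter.map_map, Ultrafilter.map_map, Ultrafilter.map_map] at a3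
    have a4 := xi_mono (fun t : Ultrafilter (Ultrafilter X × Presheaf X) × Presheaf X =>
      presheafStr_mul_le t.2 t.1) T
    have a5 : ω'.map (fun p => p.2.1 p.1) = T.map fun t => t.2.1 (sum (t.1.map Prod.fst)) :=
      Ultrafilter.map_map _ _ _
    rw [a5]
    exact le_trans (le_of_eq a3.symm) a4
  rw [← mul_assoc, ← e2]
  refine (mul_le_mul' key le_rfl).trans ?_
  rw [← e1]
  exact presheafStr_mul_le ψ ω'

/-- The `(U,Q)`-category `X̂` of presheaves on `X`. -/
def hat (X : UVCat Q) : UVCat Q where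
  carrier := Presheaf X
  str := presheafStr X
  refl := presheafStr_refl X
  trans := presheafStr_trans X

/-- The full subcategory of `X` on the points satisfying `p`. -/
def UVCat.full (X : UVCat Q) (p : X → Prop) : UVCat Q where
  carrier := {x : X // p x}
  str Υ x := X.str (Υ.map Subtype.val) x.1
  refl := fun x => X.refl x.1
  trans Υ σ x := (mul_le_mul'
    (ext_comap_le X.str (Ultrafilter.map Subtype.val) Subtype.val Υ σ) le_rfl).trans
    (X.trans _ _ _)

/-- The mate `⌜v⌝ : Y → X̂`, `y ↦ v(-,y)`, of a distributor `v : X ⇸ Y`. -/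
def mate {X Y : UVCat Q} (v : KRel Q X Y) (hv : IsDist X Y v) : Y → hat X :=
  fun y => ⟨fun σ => v σ y, isDist_mate hv y⟩

/-! ## Classes of distributors and cocompleteness -/

/-- A subcategory `J` of the category of distributors which contains `f^*` for every functor `f`
and which contains `φ : X ⇸ Y` as soon as it contains `y^* ∘ φ` for all `y ∈ Y`. -/
structure DistClass (Q : Type u) [CompletelyDistribLattice Q] [CommMonoid Q] [IsQuantale Q]
    [StrictTheory Q] where
  mem : ∀ X Y : UVCat Q, KRel Q X Y → Prop
  isDist : ∀ {X Y : UVCat Q} {φ : KRel Q X Y}, mem X Y φ → IsDist X Y φ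
  id_mem : ∀ X : UVCat Q, mem X X X.str
  comp_mem : ∀ {X Y Z : UVCat Q} {ψ : KRel Q Y Z} {φ : KRel Q X Y},
    mem Y Z ψ → mem X Y φ → mem X Z (kcomp ψ φ)
  star_mem : ∀ {X Y : UVCat Q} (f : X → Y), IsFunctor X Y f → mem Y X (upperStar Y f)
  mem_of_point : ∀ {X Y : UVCat Q} (φ : KRel Q X Y), IsDist X Y φ →
    (∀ y : Y, mem X (One Q) (kcomp (upperStar Y (pt y)) φ)) → mem X Y φ

namespace DistClass

variable (J : DistClass Q)

/-- The `(U,Q)`-category `JX`, the full subcategory of `X̂` on the `J`-distributors `X ⇸ 1`. -/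
def ideals (X : UVCat Q) : UVCat Q := (hat X).full fun ψ => J.mem X (One Q) ψ.rel

/-- The mate of a `J`-distributor takes values in `JX`. -/
theorem mem_mate {X Y : UVCat Q} {v : KRel Q X Y} (hv : J.mem X Y v) (y : Y) :
    J.mem X (One Q) (mate v (J.isDist hv) y).rel := by
  have h := J.comp_mem (J.star_mem (pt y) (isFunctor_pt y)) hv
  have e : kcomp (upperStar Y (pt y)) v = (mate v (J.isDist hv) y).rel := by
    funext σ t
    exact congrFun (congrFun (J.isDist hv).2 σ) y
  exact e ▸ h

/-- The mate `⌜v⌝ : Y → JX` of a `J`-distributor `v : X ⇸ Y`. -/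
def mate {X Y : UVCat Q} (v : KRel Q X Y) (hv : J.mem X Y v) : Y → J.ideals X :=
  fun y => ⟨UVCategory.mate v (J.isDist hv) y, J.mem_mate hv y⟩

/-- The Yoneda functor `X → JX`, `x ↦ X(-,x)`. -/
def yoneda (X : UVCat Q) : X → J.ideals X := J.mate X.str (J.id_mem X)

/-- `S : JX → X` is left adjoint to the Yoneda functor `X → JX`. A `(U,Q)`-category `X` is
`J`-cocomplete if and only if there is such an `S`. -/
def IsSupFunctor (X : UVCat Q) (S : J.ideals X → X) : Prop := IsAdjoint (J.ideals X) X S (J.yoneda X)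

/-- `x` is a supremum of the distributor `ψ : X ⇸ 1`, that is, `x_* = X ∘- ψ`. -/
def IsSupremum (X : UVCat Q) (ψ : KRel Q X (One Q)) (x : X) : Prop :=
  lowerStar X (pt x) = kext X.str ψ

/-- A functor `f : X → Y` is `J`-cocontinuous if `f (Sup φ) ≅ Sup (φ ∘ f^*)` for all `φ ∈ JX`
such that both suprema exist. -/
def CocontinuousFunctor (X Y : UVCat Q) (f : X → Y) : Prop :=
  IsFunctor X Y f ∧ ∀ φ : J.ideals X, ∀ (x : X) (y : Y), IsSupremum X φ.1.rel x →
    IsSupremum Y (kcomp φ.1.rel (upperStar Y f)) y → Y.iso (f x) y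

/-- A distributor `v : X ⇸ Y` is `J`-cocontinuous if `Sup^* ∘ v = y_* ∘ v`, where
`Sup : JY → Y` is the functor `S`. -/
def CocontinuousDist (X Y : UVCat Q) (S : J.ideals Y → Y) (v : KRel Q X Y) : Prop :=
  kcomp (upperStar Y S) v = kcomp (lowerStar (J.ideals Y) (J.yoneda Y)) v

/-- `v : X ⇸ X` is approximating: `v ∈ J` and `X ∘- v = X`. -/
def Approximating (X : UVCat Q) (v : KRel Q X X) : Prop :=
  J.mem X X v ∧ kext X.str v = X.str

/-- `v : X ⇸ X` is approximating at `x`: `v ∈ J` and `v_x = x^* ∘ v` satisfies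
`X ∘- v_x = x_*`. -/
def ApproximatingAt (X : UVCat Q) (v : KRel Q X X) (x : X) : Prop :=
  J.mem X X v ∧ kext X.str (kcomp (upperStar X (pt x)) v) = lowerStar X (pt x)

/-- `v : X ⇸ X` is the way-below distributor: the lifting of `y_* : X ⇸ JX` along
`Sup^* : X ⇸ JX`, where `Sup : JX → X` is the functor `S`. -/
def IsWayBelow (X : UVCat Q) (S : J.ideals X → X) (v : KRel Q X X) : Prop :=
  IsLifting (J.ideals X) X X (upperStar X S) (lowerStar (J.ideals X) (J.yoneda X)) v

end DistClass

end Presheaves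

end UVCategory

/-! The structure of `X̂` is itself an extension: `X̂(U⌜v⌝σ, ψ) = (ψ ∘- v)(σ)` (`presheafStr_map`).
With the hom form of adjunctions (`isAdjoint_iff`) this makes `⌜v⌝ ⊣ Sup` the same as condition 6,
and testing on `ψ = X(-,x)`, where `Sup ψ ≅ x`, gives `X ∘- v = X`. The unit `x ≤ Sup v_x` and the
counit `v(-,Sup ψ) ≤ ψ` are the two halves of the lifting property of `v`.

The step from way-below to cocontinuous is interpolation. As `γ ∘- (β ∘ α) = (γ ∘- α) ∘- β`
(`kext_kcomp`), `v ∘ v` is again approximating, so `x ≅ Sup (v ∘ v)_x`, and the lifting property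
yields `v ≤ v ∘ v`. Then `v(-,Sup φ) ≤ φ ∘ v`; the other inequality always holds.

Conversely, let each `x` be a supremum of `v_x`. Then `v ≤ X`, the unit is immediate, and
cocontinuity gives the counit: `v(-,Sup ψ) = ψ ∘ v ≤ ψ ∘ X = ψ`. For the functor form of
cocontinuity, `φ ∘ v` is the supremum of `φ ∘ ⌜v⌝^*` in `JX` (`isSupremum_presheafComp`).

All this rests on `extSum_kcomp`: `α ↦ ᾱ` turns Kleisli convolution into composition of
`Q`-relations. It combines functoriality of `U` on relations with naturality of `m`, and uses the
strictness axioms. -/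

namespace UVCategory

/-! ### Naturality properties of the extended functor `U` -/

section Relations

variable {Q : Type u} [CompletelyDistribLattice Q]

theorem ext_map_right {X Y Z : Type u} (r : X → Z → Q) (g : Y → Z) (σ : Ultrafilter X)
    (ν : Ultrafilter Y) : ext r σ (ν.map g) = ext (fun x y => r x (g y)) σ ν := by
  refine le_antisymm (le_iInf₂ fun A hA => le_iInf₂ fun B hB => ?_) (ext_comap_le r id g σ ν)
  refine (iInf₂_le A hA).trans ((iInf₂_le (g '' B) (Filter.image_mem_map hB)).trans ?_)
  refine iSup₂_mono fun x _ => iSup₂_le ?_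
  rintro _ ⟨y, hy, rfl⟩
  exact le_iSup₂_of_le y hy le_rfl

theorem ext_ext_le {X Y : Type u} (r : X → Y → Q) (Ξ : Ultrafilter (Ultrafilter X))
    (Θ : Ultrafilter (Ultrafilter Y)) : ext (ext r) Ξ Θ ≤ ext r (sum Ξ) (sum Θ) := by
  refine le_iInf₂ fun A hA => le_iInf₂ fun B hB => ?_
  refine (iInf₂_le _ (mem_sum.1 hA)).trans ((iInf₂_le _ (mem_sum.1 hB)).trans ?_)
  exact iSup₂_le fun σ hσ => iSup₂_le fun ν hν => (iInf₂_le A hσ).trans (iInf₂_le B hν)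

/-- Naturality of the multiplication with respect to `Q`-relations. -/
theorem ext_sum_right_le {X Y : Type u} (r : X → Y → Q) (σ : Ultrafilter X)
    (Θ : Ultrafilter (Ultrafilter Y)) :
    ext r σ (sum Θ) ≤ ⨆ (Ξ : Ultrafilter (Ultrafilter X)) (_ : sum Ξ = σ), ext (ext r) Ξ Θ := by
  refine ext_le _ _ _ fun ω h1 h2 => ?_
  -- `exists_refinement` asks for an ultrafilter on `UY × Y`; the `Y`-coordinate plays no role here
  -- and is filled with an arbitrary point.
  have hne (q : Ultrafilter Y) : Nonempty Y := Filter.nonempty_of_neBot (q : Filter Y)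
  obtain ⟨T, hT1, hT2⟩ := exists_refinement ω (Θ.map fun q => (q, (hne q).some)) (by
    rw [h2, Ultrafilter.map_map]; rfl)
  refine le_iSup₂_of_le ((T.map Prod.fst).map (Ultrafilter.map Prod.fst))
    (by rw [sum_map_map, hT2, h1]) ?_
  have h3 : (T.map Prod.fst).map (Ultrafilter.map Prod.snd) = Θ := by
    have := congrArg (Ultrafilter.map Prod.fst) hT1
    rw [Ultrafilter.map_map, Ultrafilter.map_map] at this
    exact (Ultrafilter.map_map _ _ _).trans this
  rw [← hT2, ← sum_map_map]
  refine (xi_sum_le _).trans ?_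
  rw [Ultrafilter.map_map]
  refine (xi_mono (g := fun ω' : Ultrafilter (X × Y) =>
    ext r (ω'.map Prod.fst) (ω'.map Prod.snd)) (fun ω' => xi_le_ext r ω') _).trans ?_
  have h4 := xi_le_ext (ext r) ((T.map Prod.fst).map fun ω' : Ultrafilter (X × Y) =>
    (ω'.map Prod.fst, ω'.map Prod.snd))
  rw [Ultrafilter.map_map, Ultrafilter.map_map, Ultrafilter.map_map] at h4
  refine h4.trans (le_of_eq ?_)
  rw [← h3]
  rfl

theorem extSum_map_right {X Y Z : Type u} (α : KRel Q X Z) (g : Y → Z) (σ : Ultrafilter X)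
    (ν : Ultrafilter Y) : extSum α σ (ν.map g) = extSum (fun τ y => α τ (g y)) σ ν :=
  iSup_congr fun _ => iSup_congr fun _ => ext_map_right _ _ _ _

theorem le_extSum_pure {X Y : Type u} (α : KRel Q X Y) (σ : Ultrafilter X) (y : Y) :
    α σ y ≤ extSum α σ (pure y) :=
  le_iSup₂_of_le (pure σ) (sum_pure σ) <| le_iInf₂ fun _ hA => le_iInf₂ fun _ hB =>
    le_iSup₂_of_le σ hA (le_iSup₂_of_le y hB le_rfl)

theorem extSum_mono {X Y : Type u} {α β : KRel Q X Y} (h : α ≤ β) (σ : Ultrafilter X)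
    (ν : Ultrafilter Y) : extSum α σ ν ≤ extSum β σ ν :=
  iSup₂_mono fun _ _ => ext_mono h _ _

theorem extSum_mul_le_kcomp [CommMonoid Q] {X Y Z : Type u} (β : KRel Q Y Z) (α : KRel Q X Y)
    (σ : Ultrafilter X) (ν : Ultrafilter Y) (z : Z) : extSum α σ ν * β ν z ≤ kcomp β α σ z :=
  le_iSup (fun ν => extSum α σ ν * β ν z) ν

end Relations

/-! ### Functoriality of `U` on relations and the calculus of convolution -/

section Convolution

variable {Q : Type u} [CompletelyDistribLattice Q] [CommMonoid Q] [IsQuantale Q]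

theorem iSup₂_mul_le_iff {ι : Type*} {p : ι → Prop} {f : ι → Q} {c z : Q} :
    (⨆ (i) (_ : p i), f i) * c ≤ z ↔ ∀ i, p i → f i * c ≤ z := by
  simp only [← Quantale.leftMulResiduation_le_iff_mul_le, iSup_le_iff]

theorem le_kext_iff {X Y Z : Type u} {γ : KRel Q X Z} {α : KRel Q X Y} {ν : Ultrafilter Y} {z : Z}
    {u : Q} : u ≤ kext γ α ν z ↔ ∀ σ, extSum α σ ν * u ≤ γ σ z := by
  simp only [kext, le_iInf_iff, Quantale.rightMulResiduation_le_iff_mul_le]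

theorem extSum_mul_kext_le {X Y Z : Type u} (γ : KRel Q X Z) (α : KRel Q X Y) (σ : Ultrafilter X)
    (ν : Ultrafilter Y) (z : Z) : extSum α σ ν * kext γ α ν z ≤ γ σ z :=
  le_kext_iff.1 le_rfl σ

theorem le_kext_iff_kcomp_le {X Y Z : Type u} {γ : KRel Q X Z} {α : KRel Q X Y} {β : KRel Q Y Z} :
    β ≤ kext γ α ↔ kcomp β α ≤ γ := by
  simp only [Pi.le_def, le_kext_iff, kcomp, iSup_le_iff]
  exact ⟨fun h σ z ν => h ν z σ, fun h ν z σ => h σ z ν⟩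

theorem kcomp_mono {X Y Z : Type u} {β β' : KRel Q Y Z} {α α' : KRel Q X Y} (hβ : β ≤ β')
    (hα : α ≤ α') : kcomp β α ≤ kcomp β' α' := fun _ z =>
  iSup_mono fun ν => mul_le_mul' (extSum_mono hα _ _) (hβ ν z)

variable [StrictTheory Q]

/-- By `ext_le` each factor may be tested on couplings, of `σ, τ` and of `τ, ν`. Two such couplings
glue along their common marginal `τ`, and `ξ` preserves `*`. -/
theorem ext_mul_ext_le {X Y Z : Type u} (r : X → Y → Q) (s : Y → Z → Q) (σ : Ultrafilter X)
    (τ : Ultrafilter Y) (ν : Ultrafilter Z) :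
    ext r σ τ * ext s τ ν ≤ ext (fun x z => ⨆ y, r x y * s y z) σ ν := by
  refine Quantale.leftMulResiduation_le_iff_mul_le.1 (ext_le _ _ _ fun ω h1 h2 => ?_)
  refine Quantale.leftMulResiduation_le_iff_mul_le.2 ?_
  refine Quantale.rightMulResiduation_le_iff_mul_le.1 (ext_le _ _ _ fun ω' h3 h4 => ?_)
  refine Quantale.rightMulResiduation_le_iff_mul_le.2 ?_
  -- The projections to `Y` of a member of `ω` and a member of `ω'` both lie in `τ`, so they meet;
  -- hence `W` can be concentrated on pairs with equal middle coordinates.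
  obtain ⟨W, hC, hW, hW'⟩ := exists_ultrafilter ω ω' {p | p.1.2 = p.2.1} fun A hA B hB => by
    have hA' : Prod.snd '' A ∈ τ := h2 ▸ Filter.image_mem_map hA
    have hB' : Prod.fst '' B ∈ τ := h3 ▸ Filter.image_mem_map hB
    obtain ⟨_, ⟨a, ha, rfl⟩, b, hb, hab⟩ := Ultrafilter.nonempty_of_mem (Filter.inter_mem hA' hB')
    exact ⟨(a, b), hab.symm, ha, hb⟩
  have h5 := StrictTheory.xi_mul (W.map fun p => (r p.1.1 p.1.2, s p.2.1 p.2.2))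
  have e1 : W.map (fun p => r p.1.1 p.1.2) = ω.map fun p => r p.1 p.2 := by
    rw [← hW, Ultrafilter.map_map]; rfl
  have e2 : W.map (fun p => s p.2.1 p.2.2) = ω'.map fun p => s p.1 p.2 := by
    rw [← hW', Ultrafilter.map_map]; rfl
  rw [Ultrafilter.map_map, Ultrafilter.map_map, Ultrafilter.map_map] at h5
  have h6 : xi (ω.map fun p => r p.1 p.2) * xi (ω'.map fun p => s p.1 p.2) =
      xi (W.map fun p => r p.1.1 p.1.2 * s p.2.1 p.2.2) := by
    rw [← e1, ← e2]; exact h5.symm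
  have h7 := xi_le_ext (fun x z => ⨆ y, r x y * s y z) (W.map fun p => (p.1.1, p.2.2))
  have e3 : (W.map fun p => (p.1.1, p.2.2)).map Prod.fst = σ := by
    rw [← h1, ← hW, Ultrafilter.map_map, Ultrafilter.map_map]; rfl
  have e4 : (W.map fun p => (p.1.1, p.2.2)).map Prod.snd = ν := by
    rw [← h4, ← hW', Ultrafilter.map_map, Ultrafilter.map_map]; rfl
  rw [e3, e4, Ultrafilter.map_map] at h7
  rw [h6]
  -- The product is bounded by the join over `y` only on matching pairs, a set in `W`, so the
  -- comparison is made through upper sets rather than by `xi_mono`.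
  refine le_trans (xi_le fun u hu => le_xi ?_) h7
  have hu' : (fun p : (X × Y) × (Y × Z) => r p.1.1 p.1.2 * s p.2.1 p.2.2) ⁻¹' Set.Ici u ∈ W := hu
  refine Ultrafilter.mem_map.2 (Filter.mem_of_superset (Filter.inter_mem hC hu') ?_)
  rintro ⟨⟨x, y⟩, y', z⟩ ⟨hy, h⟩
  obtain rfl : y = y' := hy
  exact le_trans h (le_iSup (fun y => r x y * s y z) y)

/-- Functoriality of the extension of `U` to `Q`-relations. -/
theorem ext_comp {X Y Z : Type u} (r : X → Y → Q) (s : Y → Z → Q) (σ : Ultrafilter X)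
    (ν : Ultrafilter Z) :
    ext (fun x z => ⨆ y, r x y * s y z) σ ν = ⨆ τ : Ultrafilter Y, ext r σ τ * ext s τ ν := by
  refine le_antisymm (ext_le _ _ _ fun ω h1 h2 => ?_) (iSup_le fun τ => ext_mul_ext_le r s σ τ ν)
  -- The fibre axiom lifts the coupling `ω` to ultrafilters `W` on `X × Y × Z`, exchanging `ξ` with
  -- the join over `y`; the middle marginal of `W` serves as `τ`.
  refine (StrictTheory.xi_fiber (fun t : X × Y × Z => (t.1, t.2.2))
    (fun t => r t.1 t.2.1 * s t.2.1 t.2.2) _ (fun p => iSup_le fun y =>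
      le_iSup₂_of_le (p.1, y, p.2) rfl le_rfl) ω).trans (iSup₂_le fun W hW => ?_)
  refine le_iSup_of_le (W.map fun t => t.2.1) ?_
  have h3 := StrictTheory.xi_mul (W.map fun t => (r t.1 t.2.1, s t.2.1 t.2.2))
  rw [Ultrafilter.map_map, Ultrafilter.map_map, Ultrafilter.map_map] at h3
  refine (le_of_eq h3).trans (mul_le_mul' ?_ ?_)
  · have h4 := xi_le_ext r (W.map fun t => (t.1, t.2.1))
    rw [Ultrafilter.map_map, Ultrafilter.map_map, Ultrafilter.map_map] at h4
    rw [← h1, ← hW, Ultrafilter.map_map]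
    exact h4
  · have h4 := xi_le_ext s (W.map fun t => (t.2.1, t.2.2))
    rw [Ultrafilter.map_map, Ultrafilter.map_map, Ultrafilter.map_map] at h4
    rw [← h2, ← hW, Ultrafilter.map_map]
    exact h4

/-- `extSum` is a join over the fibres of `sum`, which the fibre axiom exchanges with `ξ`; what
remains is `ext_ext_le` and associativity of `sum`. -/
theorem ext_extSum_le {X Y : Type u} (α : KRel Q X Y) (Ξ : Ultrafilter (Ultrafilter X))
    (Θ : Ultrafilter (Ultrafilter Y)) : ext (extSum α) Ξ Θ ≤ extSum α (sum Ξ) (sum Θ) := by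
  refine ext_le _ _ _ fun ω h1 h2 => ?_
  refine (StrictTheory.xi_fiber
    (fun t : Ultrafilter (Ultrafilter X) × Ultrafilter Y => (sum t.1, t.2))
    (fun t => ext α t.1 t.2) _ (fun p => iSup₂_le fun Φ hΦ =>
      le_iSup₂_of_le (Φ, p.2) (by rw [hΦ]) le_rfl) ω).trans (iSup₂_le fun W hW => ?_)
  refine (xi_le_ext (ext α) W).trans ((ext_ext_le α _ _).trans ?_)
  refine le_iSup₂_of_le (sum (W.map Prod.fst)) ?_ ?_
  · rw [← sum_map_sum, ← h1, ← hW, Ultrafilter.map_map, Ultrafilter.map_map]; rfl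
  · rw [← h2, ← hW, Ultrafilter.map_map]; exact le_rfl

theorem iSup_ext_extSum {X Y : Type u} (α : KRel Q X Y) (σ : Ultrafilter X)
    (Θ : Ultrafilter (Ultrafilter Y)) :
    ⨆ (Ξ : Ultrafilter (Ultrafilter X)) (_ : sum Ξ = σ), ext (extSum α) Ξ Θ =
      extSum α σ (sum Θ) := by
  refine le_antisymm (iSup₂_le fun Ξ h => h ▸ ext_extSum_le α Ξ Θ) (iSup₂_le fun Ξ h => ?_)
  refine (ext_sum_right_le α Ξ Θ).trans (iSup₂_le fun Φ hΦ => ?_)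
  -- Associativity of the multiplication: `Φ` lives one level higher, and flattening its inner
  -- levels leaves the total sum `σ` unchanged.
  refine le_iSup₂_of_le (Φ.map sum) (by rw [sum_map_sum, hΦ, h]) ?_
  refine le_trans (ext_mono (fun P ν => ?_) Φ Θ) (ext_comap_le (extSum α) sum id Φ Θ)
  exact le_iSup₂_of_le P rfl le_rfl

theorem extSum_kcomp {X Y Z : Type u} (β : KRel Q Y Z) (α : KRel Q X Y) (σ : Ultrafilter X)
    (ν : Ultrafilter Z) :
    extSum (kcomp β α) σ ν = ⨆ τ : Ultrafilter Y, extSum α σ τ * extSum β τ ν := by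
  have h (Ξ) : ext (kcomp β α) Ξ ν = ⨆ Θ, ext (extSum α) Ξ Θ * ext β Θ ν := ext_comp _ _ _ _
  calc extSum (kcomp β α) σ ν
      = ⨆ Θ, (⨆ (Ξ) (_ : sum Ξ = σ), ext (extSum α) Ξ Θ) * ext β Θ ν := by
        refine eq_of_forall_ge_iff fun z => ?_
        simp only [extSum, h, iSup_le_iff, iSup₂_mul_le_iff]
        exact ⟨fun H Θ Ξ hΞ => H Ξ hΞ Θ, fun H Ξ hΞ Θ => H Θ Ξ hΞ⟩
    _ = ⨆ Θ, extSum α σ (sum Θ) * ext β Θ ν := by simp only [iSup_ext_extSum]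
    _ = _ := by
      refine le_antisymm (iSup_le fun Θ => ?_) (iSup_le fun τ => ?_)
      · exact le_iSup_of_le (sum Θ) (mul_le_mul' le_rfl (le_iSup₂_of_le Θ rfl le_rfl))
      · rw [mul_comm]
        refine iSup₂_mul_le_iff.2 fun Θ hΘ => ?_
        rw [mul_comm]
        exact hΘ ▸ le_iSup (fun Θ => extSum α σ (sum Θ) * ext β Θ ν) Θ

/-- After transposing, `extSum_kcomp` makes both sides the same condition on `u`, with two
quantifiers interchanged. -/
theorem kext_kcomp {W X Y Z : Type u} (γ : KRel Q W Z) (β : KRel Q X Y) (α : KRel Q W X) :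
    kext γ (kcomp β α) = kext (kext γ α) β := by
  funext ν z
  refine eq_of_forall_le_iff fun u => ?_
  simp only [le_kext_iff, extSum_kcomp, Quantale.iSup_mul_distrib, iSup_le_iff, ← mul_assoc]
  exact forall_comm

end Convolution

/-! ### Adjunctions, the structure of `X̂` and the Yoneda lemma -/

section Categories

variable {Q : Type u} [CompletelyDistribLattice Q] [CommMonoid Q]

theorem UVCat.one_le_extSum_str (X : UVCat Q) (σ : Ultrafilter X) : 1 ≤ extSum X.str σ σ := by
  refine le_iSup₂_of_le (σ.map pure) (sum_map_pure σ) (le_iInf₂ fun A hA => le_iInf₂ fun B hB => ?_)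
  obtain ⟨x, hx, hxB⟩ := Ultrafilter.nonempty_of_mem
    (Filter.inter_mem (show pure ⁻¹' A ∈ σ from hA) hB)
  exact le_iSup₂_of_le (pure x) hx (le_iSup₂_of_le x hxB (X.refl x))

theorem UVCat.iso_of_str_eq {X : UVCat Q} {x y : X} (h : ∀ z, X.str (pure x) z = X.str (pure y) z) :
    X.iso x y :=
  ⟨(X.refl y).trans (h y).ge, (X.refl x).trans (h x).le⟩

variable [IsQuantale Q] [StrictTheory Q]

theorem UVCat.extSum_str_mul_le (X : UVCat Q) (σ τ : Ultrafilter X) (x : X) :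
    extSum X.str σ τ * X.str τ x ≤ X.str σ x :=
  extSum_mul_le _ _ _ fun Ξ h => h ▸ X.trans Ξ τ x

theorem UVCat.str_le_of_le (X : UVCat Q) {x y : X} (h : X.le x y) (σ : Ultrafilter X) :
    X.str σ x ≤ X.str σ y := by
  refine le_trans ?_ (X.extSum_str_mul_le σ (pure x) y)
  exact (mul_one _).ge.trans (mul_le_mul' (le_extSum_pure X.str σ x) h)

theorem kext_upperStar {X : Type u} (Y : UVCat Q) (f : X → Y) :
    kext Y.str (upperStar Y f) = lowerStar Y f := by
  have h (σ ν) : extSum (upperStar Y f) σ ν = extSum Y.str σ (ν.map f) :=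
    (extSum_map_right Y.str f σ ν).symm
  funext ν y
  refine le_antisymm ?_ (le_kext_iff.2 fun σ => (h σ ν).symm ▸ Y.extSum_str_mul_le _ _ _)
  -- As in the Yoneda lemma, the extension is tested at `ν.map f`, where the weight is at least `1`.
  have h' := extSum_mul_kext_le Y.str (upperStar Y f) (ν.map f) ν y
  rw [h] at h'
  exact (one_mul _).ge.trans ((mul_le_mul' (Y.one_le_extSum_str _) le_rfl).trans h')

/-- The pointwise inequality passes to ultrafilters: `σ.map pure` lies over `σ` and witnesses `1 ≤
extSum X.str σ (σ.map h)`. -/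
theorem UVCat.str_map_le (X : UVCat Q) {h : X → X} (hh : ∀ x, X.le x (h x)) (σ : Ultrafilter X)
    (x : X) : X.str (σ.map h) x ≤ X.str σ x := by
  refine le_trans ?_ (X.extSum_str_mul_le σ (σ.map h) x)
  have h1 : 1 ≤ extSum X.str σ (σ.map h) := by
    refine le_iSup₂_of_le (σ.map pure) (sum_map_pure σ) ?_
    exact (ext_pure_map (fun x y => X.str (pure x) y) h σ hh).trans
      (ext_comap_le X.str pure id σ (σ.map h))
  exact (one_mul _).ge.trans (mul_le_mul' h1 le_rfl)

/-- Unit and counit are the equation at principal ultrafilters. Functoriality of `f` comes for free: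
`X(σ,x) ≤ X(σ,g(f x)) = Y(Uf σ,f x)`. -/
theorem isAdjoint_iff {X Y : UVCat Q} {f : X → Y} {g : Y → X} (hg : IsFunctor Y X g) :
    IsAdjoint X Y f g ↔ ∀ σ y, Y.str (σ.map f) y = X.str σ (g y) := by
  refine ⟨fun h σ y => le_antisymm ?_ ?_, fun h => ?_⟩
  · refine (hg _ _).trans ?_
    rw [Ultrafilter.map_map]
    exact X.str_map_le h.2.2.1 σ (g y)
  · exact (h.1 _ _).trans (Y.str_le_of_le (h.2.2.2 y) _)
  · have hu (x) : X.le x (g (f x)) := (Y.refl (f x)).trans (h (pure x) (f x)).le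
    exact ⟨fun σ x => (X.str_le_of_le (hu x) σ).trans (h σ (f x)).ge, hg, hu,
      fun y => (X.refl (g y)).trans (h (pure (g y)) y).ge⟩

theorem kcomp_upperStar_pt {X Y : UVCat Q} {v : KRel Q X Y} (hv : IsDist X Y v) (y : Y) :
    kcomp (upperStar Y (pt y)) v = (mate v hv y).rel := by
  funext σ t
  exact congrFun (congrFun hv.2 σ) y

theorem Presheaf.extSum_rel {X : UVCat Q} (ψ : Presheaf X) (σ : Ultrafilter X) :
    extSum ψ.rel σ (pure PUnit.unit) = ψ.1 σ := by
  refine le_antisymm ?_ (le_extSum_pure ψ.rel σ PUnit.unit)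
  have h := extSum_mul_le_kcomp (One Q).str ψ.rel σ (pure PUnit.unit) PUnit.unit
  refine le_trans ((mul_one _).ge.trans (mul_le_mul' le_rfl ((One Q).refl _))) (h.trans ?_)
  exact (congrFun (congrFun ψ.2.2 σ) PUnit.unit).le

/-- The ultrafilters `ω` in the definition of `X̂` are couplings, and `ext_le` with `xi_le_ext` lets
`ext` of the evaluation relation replace the values `ξ(U ev ω)`. -/
theorem presheafStr_eq_kext {X : UVCat Q} (Υ : Ultrafilter (Presheaf X)) (ψ : Presheaf X) :
    presheafStr X Υ ψ = kext ψ.rel (fun σ (φ : Presheaf X) => φ.1 σ) Υ PUnit.unit := by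
  refine eq_of_forall_le_iff fun u => ?_
  refine Iff.trans ?_ le_kext_iff.symm
  simp only [presheafStr, le_iInf_iff, Quantale.rightMulResiduation_le_iff_mul_le]
  refine ⟨fun h σ => extSum_mul_le _ _ _ fun Ξ hΞ => ?_, fun h ω hω => ?_⟩
  · refine Quantale.leftMulResiduation_le_iff_mul_le.1 (ext_le _ _ _ fun ω h1 h2 => ?_)
    refine Quantale.leftMulResiduation_le_iff_mul_le.2 ?_
    subst h1 hΞ
    exact h ω h2
  · refine le_trans (mul_le_mul' ?_ le_rfl) (h (sum (ω.map Prod.fst)))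
    refine le_iSup₂_of_le _ rfl ?_
    rw [← hω]
    exact xi_le_ext (fun σ (φ : Presheaf X) => φ.1 σ) ω

theorem presheafStr_map {X : UVCat Q} {Y : Type u} (f : Y → Presheaf X) (ν : Ultrafilter Y)
    (ψ : Presheaf X) :
    presheafStr X (ν.map f) ψ = kext ψ.rel (fun σ y => (f y).1 σ) ν PUnit.unit := by
  refine (presheafStr_eq_kext _ _).trans ?_
  exact iInf_congr fun σ => congrArg (· ⇨ᵣ ψ.rel σ PUnit.unit)
    (extSum_map_right (fun σ (φ : Presheaf X) => φ.1 σ) f σ ν)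

theorem presheafStr_pure {X : UVCat Q} (φ ψ : Presheaf X) :
    presheafStr X (pure φ) ψ = kext ψ.rel φ.rel (pure PUnit.unit) PUnit.unit :=
  presheafStr_map (fun _ : PUnit.{u + 1} => φ) (pure PUnit.unit) ψ

theorem hat_le_iff {X : UVCat Q} (φ ψ : Presheaf X) : (hat X).le φ ψ ↔ φ.1 ≤ ψ.1 := by
  change 1 ≤ presheafStr X (pure φ) ψ ↔ _
  rw [presheafStr_pure]
  refine le_kext_iff.trans (forall_congr' fun σ => ?_)
  rw [φ.extSum_rel, mul_one]
  exact Iff.rfl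

theorem Presheaf.kcomp_str {X : UVCat Q} (ψ : Presheaf X) : kcomp ψ.rel X.str = ψ.rel := ψ.2.1

/-- The Yoneda lemma. -/
theorem Presheaf.kext_str {X : UVCat Q} (ψ : Presheaf X) : kext ψ.rel X.str = ψ.rel := by
  refine le_antisymm (fun σ t => ?_) (le_kext_iff_kcomp_le.2 ψ.kcomp_str.le)
  refine le_trans ?_ (extSum_mul_kext_le ψ.rel X.str σ σ t)
  exact (one_mul _).ge.trans (mul_le_mul' (X.one_le_extSum_str σ) le_rfl)

/-- Transposed through `presheafStr_map`, the functor inequality is `Y ∘ v ≤ v`. -/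
theorem isFunctor_mate {X Y : UVCat Q} {v : KRel Q X Y} (hv : IsDist X Y v) :
    IsFunctor Y (hat X) (mate v hv) := by
  intro σ y
  refine le_of_le_of_eq ?_ (presheafStr_map _ σ (mate v hv y)).symm
  refine le_kext_iff.2 fun τ => (extSum_mul_le_kcomp Y.str v τ σ y).trans ?_
  exact (congrFun (congrFun hv.2 τ) y).le

end Categories

/-! ### Suprema in `JX` and approximating distributors -/

section Distributors

variable {Q : Type u} [CompletelyDistribLattice Q] [CommMonoid Q] [IsQuantale Q]

theorem IsDist.le_of_le {X Y : UVCat Q} {v : KRel Q X Y} (hv : IsDist X Y v) {x y : Y}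
    (h : Y.le x y) (σ : Ultrafilter X) : v σ x ≤ v σ y := by
  refine le_of_le_of_eq ?_ (congrFun (congrFun hv.2 σ) y)
  refine le_trans ?_ (extSum_mul_le_kcomp Y.str v σ (pure x) y)
  exact (mul_one _).ge.trans (mul_le_mul' (le_extSum_pure v σ x) h)

variable [StrictTheory Q]

theorem DistClass.IsSupremum.iso {X : UVCat Q} {ψ : KRel Q X (One Q)} {x y : X}
    (hx : DistClass.IsSupremum X ψ x) (hy : DistClass.IsSupremum X ψ y) : X.iso x y :=
  UVCat.iso_of_str_eq fun z => congrFun (congrFun (hx.trans hy.symm) (pure PUnit.unit)) z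

namespace DistClass

variable (J : DistClass Q)

theorem ideals_le_iff {X : UVCat Q} (φ ψ : J.ideals X) : (J.ideals X).le φ ψ ↔ φ.1.1 ≤ ψ.1.1 :=
  hat_le_iff φ.1 ψ.1

theorem ideals_str_map_mate {X Y : UVCat Q} {v : KRel Q X Y} (hv : J.mem X Y v)
    (σ : Ultrafilter Y) (ψ : J.ideals X) :
    (J.ideals X).str (σ.map (J.mate v hv)) ψ = kext ψ.1.rel v σ PUnit.unit :=
  presheafStr_map (UVCategory.mate v (J.isDist hv)) σ ψ.1

theorem ideals_str_map_yoneda {X : UVCat Q} (σ : Ultrafilter X) (ψ : J.ideals X) :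
    (J.ideals X).str (σ.map (J.yoneda X)) ψ = ψ.1.1 σ :=
  (J.ideals_str_map_mate _ σ ψ).trans (congrFun (congrFun ψ.1.kext_str σ) PUnit.unit)

theorem isFunctor_mate {X Y : UVCat Q} {v : KRel Q X Y} (hv : J.mem X Y v) :
    IsFunctor Y (J.ideals X) (J.mate v hv) :=
  UVCategory.isFunctor_mate (J.isDist hv)

/-- The composite of a `J`-presheaf on `Y` with a `J`-distributor `X ⇸ Y`. -/
def presheafComp {X Y : UVCat Q} {v : KRel Q X Y} (hv : J.mem X Y v) (φ : J.ideals Y) :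
    J.ideals X :=
  ⟨⟨fun σ => kcomp φ.1.rel v σ PUnit.unit, J.isDist (J.comp_mem φ.2 hv)⟩, J.comp_mem φ.2 hv⟩

/-- `JX ∘- (φ ∘ ⌜v⌝^*) = (JX ∘- ⌜v⌝^*) ∘- φ = ⌜v⌝_* ∘- φ`, whose value at `θ` is `(θ ∘- v) ∘- φ = θ
∘- (φ ∘ v)`. -/
theorem isSupremum_presheafComp {X Y : UVCat Q} {v : KRel Q X Y} (hv : J.mem X Y v)
    (φ : J.ideals Y) :
    IsSupremum (J.ideals X) (kcomp φ.1.rel (upperStar (J.ideals X) (J.mate v hv)))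
      (J.presheafComp hv φ) := by
  rw [IsSupremum, kext_kcomp, kext_upperStar]
  funext ν θ
  rw [ultrafilter_punit ν]
  have h1 : lowerStar (J.ideals X) (pt (J.presheafComp hv φ)) (pure PUnit.unit) θ =
      kext (kext θ.1.rel v) φ.1.rel (pure PUnit.unit) PUnit.unit := by
    rw [← kext_kcomp]
    exact presheafStr_pure _ _
  refine h1.trans (iInf_congr fun σ => ?_)
  exact congrArg (extSum φ.1.rel σ (pure PUnit.unit) ⇨ᵣ ·) (J.ideals_str_map_mate hv σ θ).symm

theorem approximatingAt_iff {X : UVCat Q} {v : KRel Q X X} (hv : J.mem X X v) (x : X) :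
    J.ApproximatingAt X v x ↔ IsSupremum X (J.mate v hv x).1.rel x := by
  rw [ApproximatingAt, kcomp_upperStar_pt (J.isDist hv)]
  exact ⟨fun h => h.2.symm, fun h => ⟨hv, h.symm⟩⟩

/-- The pointwise condition is `X ∘- v = X` read at principal ultrafilters only. -/
theorem Approximating.approximatingAt {X : UVCat Q} {v : KRel Q X X} {J : DistClass Q}
    (h : J.Approximating X v) (x : X) : J.ApproximatingAt X v x := by
  refine (J.approximatingAt_iff h.1 x).2 ?_
  funext ν z
  rw [ultrafilter_punit ν]
  refine (congrFun (congrFun h.2 (pure x)) z).symm.trans (iInf_congr fun σ => ?_)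
  exact congrArg (· ⇨ᵣ X.str σ z) (extSum_map_right v (pt x) σ (pure PUnit.unit))

theorem Approximating.kcomp {X : UVCat Q} {v : KRel Q X X} {J : DistClass Q}
    (h : J.Approximating X v) : J.Approximating X (kcomp v v) :=
  ⟨J.comp_mem h.1 h.1, by rw [kext_kcomp, h.2, h.2]⟩

theorem IsSupremum.le_str {X : UVCat Q} {ψ : Presheaf X} {x : X} (h : IsSupremum X ψ.rel x)
    (σ : Ultrafilter X) : ψ.1 σ ≤ X.str σ x := by
  have h1 : 1 ≤ kext X.str ψ.rel (pure PUnit.unit) x :=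
    (X.refl x).trans (congrFun (congrFun h (pure PUnit.unit)) x).le
  have h2 := le_kext_iff.1 h1 σ
  rwa [ψ.extSum_rel, mul_one] at h2

/-! ### The equivalences for a `J`-cocomplete category -/

section Sup

variable {J} {X : UVCat Q} {S : J.ideals X → X}

theorem IsSupFunctor.str_map (hS : J.IsSupFunctor X S) (Υ : Ultrafilter (J.ideals X)) (x : X) :
    X.str (Υ.map S) x = (J.ideals X).str Υ (J.yoneda X x) :=
  (isAdjoint_iff (J.isFunctor_mate (J.id_mem X))).1 hS Υ x

theorem IsSupFunctor.isSupremum (hS : J.IsSupFunctor X S) (ψ : J.ideals X) :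
    IsSupremum X ψ.1.rel (S ψ) := by
  funext ν z
  rw [ultrafilter_punit ν]
  exact (hS.str_map (pure ψ) z).trans (presheafStr_pure ψ.1 (J.yoneda X z).1)

theorem IsSupFunctor.iso_yoneda (hS : J.IsSupFunctor X S) (x : X) : X.iso (S (J.yoneda X x)) x :=
  UVCat.iso_of_str_eq fun z => (hS.str_map (pure (J.yoneda X x)) z).trans
    (J.ideals_str_map_yoneda (pure x) (J.yoneda X z))

theorem kcomp_upperStar_apply {v : KRel Q X X} (hv : IsDist X X v) (σ : Ultrafilter X)
    (φ : J.ideals X) : UVCategory.kcomp (upperStar X S) v σ φ = v σ (S φ) :=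
  congrFun (congrFun hv.2 σ) (S φ)

theorem kcomp_lowerStar_yoneda_apply (v : KRel Q X X) (σ : Ultrafilter X) (φ : J.ideals X) :
    UVCategory.kcomp (lowerStar (J.ideals X) (J.yoneda X)) v σ φ =
      UVCategory.kcomp φ.1.rel v σ PUnit.unit :=
  iSup_congr fun ν => congrArg (extSum v σ ν * ·) (J.ideals_str_map_yoneda ν φ)

/-- `Sup^* ∘ v` is evaluated by the distributor law for `v`, and `y_* ∘ v` by the Yoneda lemma. -/
theorem cocontinuousDist_iff {v : KRel Q X X} (hv : IsDist X X v) :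
    J.CocontinuousDist X X S v ↔
      ∀ (φ : J.ideals X) (σ : Ultrafilter X),
        v σ (S φ) = UVCategory.kcomp φ.1.rel v σ PUnit.unit := by
  simp only [CocontinuousDist, funext_iff, kcomp_upperStar_apply hv, kcomp_lowerStar_yoneda_apply]
  exact forall_comm

theorem isWayBelow_iff {v : KRel Q X X} :
    J.IsWayBelow X S v ↔ IsDist X X v ∧ ∀ γ : KRel Q X X, IsDist X X γ →
      ((∀ (φ : J.ideals X) (σ : Ultrafilter X), γ σ (S φ) ≤ φ.1.1 σ) ↔ γ ≤ v) := by
  refine and_congr Iff.rfl (forall₂_congr fun γ hγ => ?_)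
  refine iff_congr ?_ Iff.rfl
  rw [forall_comm]
  refine forall₂_congr fun σ φ => ?_
  rw [kcomp_upperStar_apply hγ]
  exact iff_of_eq (congrArg (γ σ (S φ) ≤ ·) (J.ideals_str_map_yoneda σ φ))

variable {v : KRel Q X X} (hv : J.mem X X v)

theorem isAdjoint_mate_iff (hS : J.IsSupFunctor X S) :
    IsAdjoint X (J.ideals X) (J.mate v hv) S ↔
      ∀ (σ : Ultrafilter X) (ψ : J.ideals X),
        (hat X).str (σ.map (UVCategory.mate v (J.isDist hv))) ψ.1 = X.str σ (S ψ) :=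
  isAdjoint_iff hS.1

theorem approximating_of_isAdjoint_mate (hS : J.IsSupFunctor X S)
    (h : IsAdjoint X (J.ideals X) (J.mate v hv) S) : J.Approximating X v := by
  refine ⟨hv, ?_⟩
  funext σ x
  have h1 := ((isAdjoint_iff hS.1).1 h σ (J.yoneda X x)).symm.trans (J.ideals_str_map_mate hv σ _)
  refine h1.symm.trans (le_antisymm ?_ ?_)
  · exact X.str_le_of_le (hS.iso_yoneda x).1 σ
  · exact X.str_le_of_le (hS.iso_yoneda x).2 σ

theorem isWayBelow_of_isAdjoint_mate (h : IsAdjoint X (J.ideals X) (J.mate v hv) S) :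
    J.IsWayBelow X S v := by
  refine isWayBelow_iff.2 ⟨J.isDist hv, fun γ hγ => ⟨fun H σ x => ?_, fun H φ σ => ?_⟩⟩
  · exact (hγ.le_of_le (h.2.2.1 x) σ).trans (H (J.mate v hv x) σ)
  · exact (H σ (S φ)).trans ((J.ideals_le_iff _ _).1 (h.2.2.2 φ) σ)

/-- The half of cocontinuity that always holds, since `φ ≤ X(-,Sup φ)`. -/
theorem kcomp_rel_le (hv : IsDist X X v) (hS : J.IsSupFunctor X S) (φ : J.ideals X) (σ : Ultrafilter X) :
    UVCategory.kcomp φ.1.rel v σ PUnit.unit ≤ v σ (S φ) := by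
  refine le_of_le_of_eq ?_ (congrFun (congrFun hv.2 σ) (S φ))
  exact iSup_mono fun ν => mul_le_mul' le_rfl ((hS.isSupremum φ).le_str ν)

theorem cocontinuousDist_of_isWayBelow (hS : J.IsSupFunctor X S) (ha : J.Approximating X v)
    (hw : J.IsWayBelow X S v) : J.CocontinuousDist X X S v := by
  have hv := J.isDist ha.1
  -- The lifting property at `γ = v`: `v(-,Sup φ) ≤ φ`.
  have h1 := ((isWayBelow_iff.1 hw).2 v hv).2 le_rfl
  -- Interpolation: `x` is a supremum of `ψ = (v ∘ v)(-,x)`, so `v(-,x) ≤ v(-,Sup ψ) ≤ ψ`.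
  have h2 (σ x) : v σ x ≤ UVCategory.kcomp v v σ x := by
    let ψ := J.mate (UVCategory.kcomp v v) ha.kcomp.1 x
    have h3 : X.iso x (S ψ) :=
      ((J.approximatingAt_iff ha.kcomp.1 x).1 (ha.kcomp.approximatingAt x)).iso (hS.isSupremum ψ)
    exact (hv.le_of_le h3.1 σ).trans (h1 ψ σ)
  refine (cocontinuousDist_iff hv).2 fun φ σ =>
    le_antisymm ((h2 σ (S φ)).trans ?_) (kcomp_rel_le hv hS φ σ)
  exact iSup_mono fun ν => mul_le_mul' le_rfl (h1 φ ν)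

theorem isAdjoint_mate_of_approximatingAt (hS : J.IsSupFunctor X S)
    (ha : ∀ x, J.ApproximatingAt X v x) (hc : J.CocontinuousDist X X S v) :
    IsAdjoint X (J.ideals X) (J.mate v hv) S := by
  have ha' (x) := (J.approximatingAt_iff hv x).1 (ha x)
  refine ⟨J.isFunctor_mate hv, hS.1, fun x => ((ha' x).iso (hS.isSupremum _)).1, fun ψ => ?_⟩
  refine (J.ideals_le_iff _ _).2 fun σ => ?_
  refine ((cocontinuousDist_iff (J.isDist hv)).1 hc ψ σ).le.trans ?_
  refine le_of_le_of_eq ?_ (congrFun (congrFun ψ.1.kcomp_str σ) PUnit.unit)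
  -- `v ≤ X`, because each `x` is a supremum of `v(-,x)`.
  exact kcomp_mono le_rfl (fun τ x => (ha' x).le_str τ) σ PUnit.unit

/-- Suprema are unique up to `≅`, so it suffices to compare at `S φ` and `φ ∘ v`; in `JX` isomorphic
points are equal as functions on `UX`. -/
theorem cocontinuousFunctor_mate_iff (hS : J.IsSupFunctor X S) :
    J.CocontinuousFunctor X (J.ideals X) (J.mate v hv) ↔ J.CocontinuousDist X X S v := by
  rw [cocontinuousDist_iff (J.isDist hv)]
  refine ⟨fun h φ σ => ?_, fun h => ⟨J.isFunctor_mate hv, fun φ x ψ hx hψ => ?_⟩⟩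
  · have h1 := h.2 φ (S φ) (J.presheafComp hv φ) (hS.isSupremum φ) (J.isSupremum_presheafComp hv φ)
    exact le_antisymm ((J.ideals_le_iff _ _).1 h1.1 σ) ((J.ideals_le_iff _ _).1 h1.2 σ)
  · have hx' := hx.iso (hS.isSupremum φ)
    have hψ' := hψ.iso (J.isSupremum_presheafComp hv φ)
    refine ⟨(J.ideals_le_iff _ _).2 fun σ => ?_, (J.ideals_le_iff _ _).2 fun σ => ?_⟩
    · exact ((J.isDist hv).le_of_le hx'.1 σ).trans
        ((h φ σ).le.trans ((J.ideals_le_iff _ _).1 hψ'.2 σ))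
    · exact ((J.ideals_le_iff _ _).1 hψ'.1 σ).trans
        ((h φ σ).ge.trans ((J.isDist hv).le_of_le hx'.2 σ))

end Sup

end DistClass

end Distributors

end UVCategory

/-! ### The main theorem -/

theorem mainTheorem5 {Q : Type u} [CompletelyDistribLattice Q] [CommMonoid Q] [IsQuantale Q]
    [UVCategory.StrictTheory Q] (J : UVCategory.DistClass Q) (X : UVCategory.UVCat Q)
    (S : J.ideals X → X) (hS : J.IsSupFunctor X S)
    (v : UVCategory.KRel Q X X) (hv : J.mem X X v) :
    List.TFAE [
      UVCategory.IsAdjoint X (J.ideals X) (J.mate v hv) S,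
      J.Approximating X v ∧ J.IsWayBelow X S v,
      J.Approximating X v ∧ J.CocontinuousDist X X S v,
      (∀ x : X, J.ApproximatingAt X v x) ∧ J.CocontinuousDist X X S v,
      (∀ x : X, J.ApproximatingAt X v x) ∧
        J.CocontinuousFunctor X (J.ideals X) (J.mate v hv),
      ∀ (σ : Ultrafilter X) (ψ : J.ideals X),
        (UVCategory.hat X).str (σ.map (UVCategory.mate v (J.isDist hv))) ψ.1 = X.str σ (S ψ)] := by
  tfae_have 1 ↔ 6 := UVCategory.DistClass.isAdjoint_mate_iff hv hS
  tfae_have 1 → 2 := fun h => ⟨UVCategory.DistClass.approximating_of_isAdjoint_mate hv hS h,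
    UVCategory.DistClass.isWayBelow_of_isAdjoint_mate hv h⟩
  tfae_have 2 → 3 := fun h =>
    ⟨h.1, UVCategory.DistClass.cocontinuousDist_of_isWayBelow hS h.1 h.2⟩
  tfae_have 3 → 4 := fun h => ⟨h.1.approximatingAt, h.2⟩
  tfae_have 4 → 1 := fun h =>
    UVCategory.DistClass.isAdjoint_mate_of_approximatingAt hv hS h.1 h.2
  tfae_have 4 ↔ 5 := and_congr Iff.rfl
    (UVCategory.DistClass.cocontinuousFunctor_mate_iff hv hS).symm
  tfae_finish
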